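/- Let $N\ge 4$, let $\Omega\subset\mathbb R^N$ be a bounded domain (nonempty, open, connected), and let $2^*=\frac{2N}{N-2}$. Let $\lambda_1(\Omega)$ be the first eigenvalue of $-\Delta$ on $\Omega$ with Dirichlet boundary conditions, $\lambda_1(\Omega)=\inf\{\int_\Omega|\nabla u|^2/\int_\Omega|u|^2 : u\in H^1_0(\Omega)\setminus\{0\}\}$. Put $$\mathbb I_4=[0,\sqrt6/9],\qquad \mathbb I_5=[0,\mu^*],\qquad \mathbb I_6=[0,1],\qquad \mathbb I_N=[0,+\infty)\ \ (N\ge 7),$$ where $\mu^*$ is the largest $\mu>0$ for which there are $k,l>0$ with $k^{1/3}l=1$, $\mu l^{7/3}+k^{7/3}=l$ and $\frac15\left(k^2+\frac37l^2\right)\le\frac{3}{35}\mu^{-3/2}$ (these are the exponents $2^*-3$ and $2^*-1$ for $N=5$). For $\lambda\in\mathbb R$, $\mu\ge0$ and $(u,v)\in H^1_0(\Omega)\times H^1_0(\Omega)$ let $$\mathcal J(u,v)=\frac12\int_\Omega|\nabla u|^2-\frac\lambda2\int_\Omega|u|^2+\frac1{2(2^*-1)}\int_\Omega|\nabla v|^2-\frac{\mu}{2^*(2^*-1)}\int_\Omega|v|^{2^*}-\frac1{2^*-1}\int_\Omega|u|^{2^*-1}v,$$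 $$H(u,v)=\int_\Omega|\nabla u|^2-\lambda\int_\Omega|u|^2+\frac1{2^*-1}\int_\Omega|\nabla v|^2-\frac{\mu}{2^*-1}\int_\Omega|v|^{2^*}-\frac{2^*}{2^*-1}\int_\Omega|u|^{2^*-1}v,$$ and let $$\mathcal N'=\{(u,v)\in (H^1_0(\Omega)\times H^1_0(\Omega))\setminus\{(0,0)\} : H(u,v)=0\},$$ $$\mathcal A=\Big\{(u,v)\in H^1_0(\Omega)\times H^1_0(\Omega) : \mu\int_\Omega|v|^{2^*}+2^*\int_\Omega|u|^{2^*-1}v>0\Big\},$$ $$\Gamma=\{w\in C([0,1],H^1_0(\Omega)\times H^1_0(\Omega)) : w(0)=(0,0),\ \mathcal J(w(1))<0\},\qquad \mathcal B=\inf_{w\in\Gamma}\max_{t\in[0,1]}\mathcal J(w(t)).$$ If $\lambda\in(0,\lambda_1(\Omega))$ and $\mu\in\mathbb I_N$, then $$\inf_{(u,v)\in\mathcal N'}\mathcal J(u,v)=\inf_{(u,v)\in\mathcal A}\ \max_{t\ge0}\mathcal J(tu,tv)=\mathcal B>0,$$ where all the maxima written here (over $t\ge 0$ for each $(u,v)\in\mathcal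 A$, and over $t\in[0,1]$ for each $w\in\Gamma$) are attained. -/

import Mathlib

open MeasureTheory Set
open scoped ContDiff

noncomputable section

namespace CriticalSystem

/-- The underlying Euclidean space `ℝ^N`. -/
abbrev E (N : ℕ) : Type := EuclideanSpace ℝ (Fin N)

/-- The Hilbert space `L²(Ω) × L²(Ω; ℝ^N)` with
`‖(u, g)‖² = ‖u‖₂² + ‖g‖₂²`; the map `u ↦ (u, ∇u)` embeds `H¹(Ω)` in it isometrically. -/
abbrev L2Pair {N : ℕ} (Ω : Set (E N)) : Type :=
  WithLp 2 (Lp ℝ 2 (volume.restrict Ω) × Lp (E N) 2 (volume.restrict Ω))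

/-- `φ ∈ C_c^∞(Ω)`. -/
structure IsTestFunction {N : ℕ} (Ω : Set (E N)) (φ : E N → ℝ) : Prop where
  smooth : ContDiff ℝ ∞ φ
  compact : HasCompactSupport φ
  supp : tsupport φ ⊆ Ω

theorem gradient_add' {N : ℕ} {f g : E N → ℝ} (hf : Differentiable ℝ f)
    (hg : Differentiable ℝ g) :
    gradient (f + g) = gradient f + gradient g := by
  funext x
  simp only [gradient, Pi.add_apply]
  rw [fderiv_add (hf x) (hg x), map_add]

theorem gradient_const_smul' {N : ℕ} {f : E N → ℝ} (c : ℝ) (hf : Differentiable ℝ f) :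
    gradient (c • f) = c • gradient f := by
  funext x
  simp only [gradient, Pi.smul_apply]
  rw [fderiv_const_smul (hf x)]
  simp

/-- The pairs `(φ, ∇φ)` with `φ ∈ C_c^∞(Ω)`. -/
def testGraph {N : ℕ} (Ω : Set (E N)) : Submodule ℝ (L2Pair Ω) where
  carrier := {p | ∃ φ : E N → ℝ, IsTestFunction Ω φ ∧
    p.fst =ᵐ[volume.restrict Ω] φ ∧ p.snd =ᵐ[volume.restrict Ω] gradient φ}
  zero_mem' := by
    refine ⟨0, ⟨contDiff_const, HasCompactSupport.zero, by simp [tsupport]⟩, ?_, ?_⟩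
    · exact Lp.coeFn_zero ℝ 2 _
    · have h : gradient (0 : E N → ℝ) = 0 := by
        funext x
        simp [gradient]
      rw [h]
      exact Lp.coeFn_zero (E N) 2 _
  add_mem' := by
    rintro p q ⟨φ, hφ, h1, h2⟩ ⟨ψ, hψ, h3, h4⟩
    refine ⟨φ + ψ, ⟨hφ.smooth.add hψ.smooth, hφ.compact.add hψ.compact,
      (tsupport_add φ ψ).trans (union_subset hφ.supp hψ.supp)⟩, ?_, ?_⟩
    · exact (Lp.coeFn_add p.fst q.fst).trans (h1.add h3)
    · rw [gradient_add' (hφ.smooth.differentiable (by simp))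
        (hψ.smooth.differentiable (by simp))]
      exact (Lp.coeFn_add p.snd q.snd).trans (h2.add h4)
  smul_mem' := by
    rintro c p ⟨φ, hφ, h1, h2⟩
    refine ⟨c • φ, ⟨hφ.smooth.const_smul c, hφ.compact.smul_left (f := fun _ => c),
      (closure_mono (Function.support_const_smul_subset c φ)).trans hφ.supp⟩, ?_, ?_⟩
    · exact (Lp.coeFn_smul c p.fst).trans (h1.const_smul c)
    · rw [gradient_const_smul' c (hφ.smooth.differentiable (by simp))]
      exact (Lp.coeFn_smul c p.snd).trans (h2.const_smul c)

/-- The Sobolev space `H¹₀(Ω)`: the closure of `C_c^∞(Ω)` in the `H¹` norm. An element is stored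
as the pair `(u, ∇u)` of the function and its weak gradient; the norm is the `H¹` norm. -/
abbrev H10 {N : ℕ} (Ω : Set (E N)) : Type := (testGraph Ω).topologicalClosure

/-- The function `u ∈ L²(Ω)` underlying an element of `H¹₀(Ω)`. -/
def H10.fn {N : ℕ} {Ω : Set (E N)} (u : H10 Ω) : Lp ℝ 2 (volume.restrict Ω) :=
  (u : L2Pair Ω).fst

/-- The weak gradient `∇u ∈ L²(Ω; ℝ^N)` of an element of `H¹₀(Ω)`. -/
def H10.grad {N : ℕ} {Ω : Set (E N)} (u : H10 Ω) : Lp (E N) 2 (volume.restrict Ω) :=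
  (u : L2Pair Ω).snd

/-- The critical Sobolev exponent `2^* = 2N/(N-2)`. -/
def critExp (N : ℕ) : ℝ := 2 * (N : ℝ) / ((N : ℝ) - 2)

variable {N : ℕ} {Ω : Set (E N)}

/-- `‖∇u‖₂² = ∫_Ω |∇u|²`. -/
def dirichletInt (u : H10 Ω) : ℝ := ∫ x in Ω, ‖u.grad x‖ ^ 2

/-- `‖u‖₂² = ∫_Ω |u|²`. -/
def massInt (u : H10 Ω) : ℝ := ∫ x in Ω, |u.fn x| ^ 2

/-- `‖v‖_{2^*}^{2^*} = ∫_Ω |v|^{2^*}`. -/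
def critInt (v : H10 Ω) : ℝ := ∫ x in Ω, |v.fn x| ^ critExp N

/-- `∫_Ω |u|^{2^*-1} v`. -/
def couplingInt (u v : H10 Ω) : ℝ := ∫ x in Ω, |u.fn x| ^ (critExp N - 1) * v.fn x

/-- The first Dirichlet eigenvalue `λ₁(Ω)` of `-Δ`, as the infimum of the Rayleigh quotient
over `H¹₀(Ω) \ {0}`. -/
def firstEigenvalue (Ω : Set (E N)) : ℝ :=
  sInf {r : ℝ | ∃ u : H10 Ω, u.fn ≠ 0 ∧ r = dirichletInt u / massInt u}

/-- The energy functional `𝒥` on `H¹₀(Ω) × H¹₀(Ω)`. -/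
def energy (lam μ : ℝ) (p : H10 Ω × H10 Ω) : ℝ :=
  1 / 2 * dirichletInt p.1 - lam / 2 * massInt p.1
    + 1 / (2 * (critExp N - 1)) * dirichletInt p.2
    - μ / (critExp N * (critExp N - 1)) * critInt p.2
    - 1 / (critExp N - 1) * couplingInt p.1 p.2

/-- The functional `H` that defines the Nehari-type set `𝒩'`. -/
def nehariFun (lam μ : ℝ) (p : H10 Ω × H10 Ω) : ℝ :=
  dirichletInt p.1 - lam * massInt p.1 + 1 / (critExp N - 1) * dirichletInt p.2
    - μ / (critExp N - 1) * critInt p.2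
    - critExp N / (critExp N - 1) * couplingInt p.1 p.2

/-- The set `𝒩'`. -/
def nehariSet (Ω : Set (E N)) (lam μ : ℝ) : Set (H10 Ω × H10 Ω) :=
  {p | p ≠ 0 ∧ nehariFun lam μ p = 0}

/-- The set `𝒜` of admissible pairs. -/
def admissible (Ω : Set (E N)) (μ : ℝ) : Set (H10 Ω × H10 Ω) :=
  {p | 0 < μ * critInt p.2 + critExp N * couplingInt p.1 p.2}

/-- The values `𝒥(tu, tv)`, `t ≥ 0`. -/
def rayValues (lam μ : ℝ) (p : H10 Ω × H10 Ω) : Set ℝ :=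
  (fun t : ℝ => energy lam μ (t • p)) '' Ici 0

/-- The class `Γ` of continuous paths in `H¹₀(Ω) × H¹₀(Ω)` from `(0,0)` to a point where
`𝒥 < 0`. -/
def paths (Ω : Set (E N)) (lam μ : ℝ) : Set C(unitInterval, H10 Ω × H10 Ω) :=
  {w | w 0 = 0 ∧ energy lam μ (w 1) < 0}

/-- The values of `𝒥` along a path. -/
def pathValues (lam μ : ℝ) (w : C(unitInterval, H10 Ω × H10 Ω)) : Set ℝ :=
  range fun t => energy lam μ (w t)

/-- `inf_{𝒩'} 𝒥`. -/
def nehariLevel (Ω : Set (E N)) (lam μ : ℝ) : ℝ :=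
  sInf (energy lam μ '' nehariSet Ω lam μ)

/-- `inf_{(u,v) ∈ 𝒜} max_{t ≥ 0} 𝒥(tu, tv)`. -/
def admissibleLevel (Ω : Set (E N)) (lam μ : ℝ) : ℝ :=
  sInf {m : ℝ | ∃ p ∈ admissible Ω μ, IsGreatest (rayValues lam μ p) m}

/-- The mountain pass level `ℬ = inf_{w ∈ Γ} max_{t ∈ [0,1]} 𝒥(w(t))`. -/
def mountainPassLevel (Ω : Set (E N)) (lam μ : ℝ) : ℝ :=
  sInf {m : ℝ | ∃ w ∈ paths Ω lam μ, IsGreatest (pathValues lam μ w) m}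

/-- The threshold `μ^*` in dimension `5` (where `2^* = 10/3`). On the limit problem in `ℝ⁵` the
synchronized solution `(kU, lU)` built on an Aubin-Talenti instanton `U`, where `k, l > 0` solve
`k^{2^*-3} l = 1` and `μ l^{2^*-1} + k^{2^*-1} = l`, has the level
`(1/5)(k² + (3/7) l²) S^{5/2}`, and the semitrivial solution `(0, μ^{-3/4} U)` has the level
`3/(35 μ^{3/2}) S^{5/2}`. The threshold is the largest `μ > 0` for which some synchronized
solution has a level at most the semitrivial one. (With `m = k/l` one finds
`μ = m^{1/3}(1 - m²)`, and the comparison of levels becomes `(1 + 7m²/3)(1 - m²)^{3/2} ≤ 1`.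
The left side exceeds `1` on an interval `0 < m < m*`, with `m*² > 1/7`, and is at most `1` on
`[m*, 1)`, where `μ` decreases in `m`; so the set below is the interval `(0, μ^*]`, with
`μ^* = m*^{1/3}(1 - m*²)`.) -/
def muStar : ℝ :=
  sSup {μ : ℝ | 0 < μ ∧ ∃ k l : ℝ, 0 < k ∧ 0 < l ∧
    k ^ (critExp 5 - 3) * l = 1 ∧
    μ * l ^ (critExp 5 - 1) + k ^ (critExp 5 - 1) = l ∧
    1 / 5 * (k ^ 2 + 3 / 7 * l ^ 2) ≤ 3 / (35 * μ ^ (3 / 2 : ℝ))}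

/-- The range `𝕀_N` of admitted parameters `μ`, for `N ≥ 4`. -/
def paramRange (N : ℕ) : Set ℝ :=
  if N = 4 then Icc 0 (Real.sqrt 6 / 9)
  else if N = 5 then Icc 0 muStar
  else if N = 6 then Icc 0 1
  else Ici 0

end CriticalSystem

end

/-! With `q = 2^*`, the energy is `Q / 2 - G / q`, where `Q = quadPart` is quadratic and `G =
critPart` is homogeneous of degree `q > 2` under `t ≥ 0`. Then `H = Q - G`, and `𝒜` is `{G > 0}`. On
a ray with `G > 0`, `t² Q / 2 - t^q G / q` attains its maximum at a point of `𝒩'`, and every point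
of `𝒩'` maximises `𝒥` on its own ray; so the first two levels are infima of the same set of values
(`nehari_values_eq`).

A path in `Γ` starts where `Q > G` (near, but off, the origin) and ends where `Q ≤ G`, so it meets
`𝒩'` (`exists_path_mem_nehari`); conversely a long segment of the ray through a point of `𝒩'`
belongs to `Γ` (`exists_path_le_ray`). On `𝒩'` the energy is `(1/2 - 1/q) Q`, and `𝒩'` stays away
from the origin, so the level is positive.

The analysis consists in checking the hypotheses: `Q` is coercive because `λ < λ₁(Ω)`, and the
Sobolev embedding into `L^{2^*}` gives the growth and continuity of `G`. -/

namespace CriticalSystem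

/-! ### Abstract equality of Nehari, ray and mountain pass levels -/

/-- A functional `Q / 2 - G / q` whose quadratic part `Q` is coercive and whose remainder `G` is
positively homogeneous of degree `q > 2`, bounded by the `q`-th power of the norm and positive
somewhere. -/
structure FiberedFunctional {X : Type*} [NormedAddCommGroup X] [NormedSpace ℝ X]
    (Q G : X → ℝ) (q : ℝ) : Prop where
  two_lt : 2 < q
  continuous_quad : Continuous Q
  continuous_hom : Continuous G
  quad_smul : ∀ (t : ℝ) (x : X), Q (t • x) = t ^ 2 * Q x
  hom_smul : ∀ (t : ℝ) (x : X), 0 ≤ t → G (t • x) = t ^ q * G x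
  coercive : ∃ c : ℝ, 0 < c ∧ ∀ x, c * ‖x‖ ^ 2 ≤ Q x
  growth : ∃ C : ℝ, 0 < C ∧ ∀ x, G x ≤ C * ‖x‖ ^ q
  exists_pos : ∃ x, 0 < G x

/-- Bernoulli's inequality for `(1 + (s² - 1))^(q/2)`, that is, convexity of `x^(q/2)` at `x = 1`.
It says that `s = 1` maximises the ray profile. -/
theorem sq_div_sub_rpow_div_le {q s : ℝ} (hq : 2 < q) (hs : 0 ≤ s) :
    s ^ 2 / 2 - s ^ q / q ≤ 1 / 2 - 1 / q := by
  have h := one_add_mul_self_le_rpow_one_add (s := s ^ 2 - 1) (by nlinarith [sq_nonneg s])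
    (p := q / 2) (by linarith)
  have e : (1 + (s ^ 2 - 1)) ^ (q / 2) = s ^ q := by
    rw [show 1 + (s ^ 2 - 1) = s ^ (2 : ℝ) by norm_num, ← Real.rpow_mul hs]
    congr 1; ring
  rw [e] at h
  have : (1 + q / 2 * (s ^ 2 - 1)) / q ≤ s ^ q / q := by gcongr
  have e2 : (1 + q / 2 * (s ^ 2 - 1)) / q = 1 / q + (s ^ 2 - 1) / 2 := by field_simp
  linarith

namespace FiberedFunctional

variable {X : Type*} [NormedAddCommGroup X] [NormedSpace ℝ X] {Q G : X → ℝ} {q : ℝ}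

theorem quad_pos (h : FiberedFunctional Q G q) {x : X} (hx : x ≠ 0) : 0 < Q x := by
  obtain ⟨c, hc, hQ⟩ := h.coercive
  have : 0 < ‖x‖ := norm_pos_iff.mpr hx
  exact lt_of_lt_of_le (by positivity) (hQ x)

theorem hom_zero (h : FiberedFunctional Q G q) : G 0 = 0 := by
  have := h.hom_smul 0 0 le_rfl
  rwa [Real.zero_rpow (by linarith [h.two_lt]), zero_mul, smul_zero] at this

theorem quad_zero (h : FiberedFunctional Q G q) : Q 0 = 0 := by
  simpa using h.quad_smul 0 0

theorem ne_zero_of_hom_pos (h : FiberedFunctional Q G q) {x : X} (hx : 0 < G x) : x ≠ 0 := by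
  rintro rfl
  exact hx.ne' h.hom_zero

/-- Since `q > 2`, `C ‖x‖^(q-2) < c` near the origin. This separates the Nehari set from `0`. -/
theorem exists_hom_lt_quad (h : FiberedFunctional Q G q) :
    ∃ r : ℝ, 0 < r ∧ ∀ x, x ≠ 0 → ‖x‖ < r → G x < Q x := by
  obtain ⟨c, hc, hQ⟩ := h.coercive
  obtain ⟨C, hC, hG⟩ := h.growth
  have hq := h.two_lt
  refine ⟨(c / C) ^ (q - 2)⁻¹, by positivity, fun x hx hr => ?_⟩
  have hx0 : 0 < ‖x‖ := norm_pos_iff.mpr hx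
  have h1 : ‖x‖ ^ (q - 2) < c / C := by
    rwa [Real.lt_rpow_inv_iff_of_pos hx0.le (by positivity) (by linarith)] at hr
  have h2 : ‖x‖ ^ q = ‖x‖ ^ (q - 2) * ‖x‖ ^ 2 := by
    rw [← Real.rpow_two, ← Real.rpow_add hx0]; congr 1; ring
  calc G x ≤ C * ‖x‖ ^ q := hG x
    _ = C * ‖x‖ ^ (q - 2) * ‖x‖ ^ 2 := by rw [h2]; ring
    _ < c * ‖x‖ ^ 2 := by
      gcongr
      rwa [lt_div_iff₀ hC, mul_comm] at h1
    _ ≤ Q x := hQ x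

theorem exists_smul_nehari (h : FiberedFunctional Q G q) {x : X} (hx : 0 < G x) :
    ∃ t : ℝ, 0 < t ∧ Q (t • x) = G (t • x) := by
  have hQ := h.quad_pos (h.ne_zero_of_hom_pos hx)
  have hq := h.two_lt
  -- The nonzero root of `t² Q = t^q G`.
  refine ⟨(Q x / G x) ^ (q - 2)⁻¹, by positivity, ?_⟩
  set t := (Q x / G x) ^ (q - 2)⁻¹ with ht
  have ht0 : 0 < t := by positivity
  have h1 : t ^ (q - 2) = Q x / G x := by
    rw [ht, Real.rpow_inv_rpow (by positivity) (by linarith)]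
  have h2 : t ^ q = t ^ (q - 2) * t ^ 2 := by
    rw [← Real.rpow_two, ← Real.rpow_add ht0]; congr 1; ring
  rw [h.quad_smul, h.hom_smul _ _ ht0.le, h2, h1]
  field_simp

variable {J : X → ℝ}

theorem isGreatest_ray_of_nehari (h : FiberedFunctional Q G q)
    (hJ : ∀ x, J x = Q x / 2 - G x / q) {x : X} (hx : x ≠ 0) (hN : Q x = G x) :
    IsGreatest ((fun t : ℝ => J (t • x)) '' Ici 0) (J x) := by
  refine ⟨⟨1, by simp, by simp⟩, ?_⟩
  rintro _ ⟨t, ht, rfl⟩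
  have := mul_le_mul_of_nonneg_right (sq_div_sub_rpow_div_le h.two_lt ht) (h.quad_pos hx).le
  simp only [hJ, h.quad_smul, h.hom_smul t x ht, ← hN]
  linarith [show (t ^ 2 / 2 - t ^ q / q) * Q x = t ^ 2 * Q x / 2 - t ^ q * Q x / q by ring,
    show (1 / 2 - 1 / q) * Q x = Q x / 2 - Q x / q by ring]

theorem exists_nehari_isGreatest_ray (h : FiberedFunctional Q G q)
    (hJ : ∀ x, J x = Q x / 2 - G x / q) {x : X} (hx : 0 < G x) :
    ∃ y, y ≠ 0 ∧ Q y = G y ∧ IsGreatest ((fun t : ℝ => J (t • x)) '' Ici 0) (J y) := by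
  obtain ⟨t, ht, hN⟩ := h.exists_smul_nehari hx
  have hne : t • x ≠ 0 := smul_ne_zero ht.ne' (h.ne_zero_of_hom_pos hx)
  refine ⟨t • x, hne, hN, ⟨⟨t, ht.le, rfl⟩, ?_⟩⟩
  rintro _ ⟨s, hs, rfl⟩
  refine (h.isGreatest_ray_of_nehari hJ hne hN).2 ⟨s / t, div_nonneg hs ht.le, ?_⟩
  simp only [smul_smul]
  rw [div_mul_cancel₀ _ ht.ne']

/-- The crossing is the first time at which `Q ≤ G` away from the origin: before it `G ≤ Q`, and
continuity gives equality there. -/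
theorem exists_path_mem_nehari (h : FiberedFunctional Q G q)
    (hJ : ∀ x, J x = Q x / 2 - G x / q) {w : C(unitInterval, X)} (h0 : w 0 = 0)
    (h1 : J (w 1) < 0) : ∃ t, w t ≠ 0 ∧ Q (w t) = G (w t) := by
  obtain ⟨r, hr, hrQ⟩ := h.exists_hom_lt_quad
  have hq := h.two_lt
  have hQw : Continuous fun t => Q (w t) := h.continuous_quad.comp w.continuous
  have hGw : Continuous fun t => G (w t) := h.continuous_hom.comp w.continuous
  -- The condition `r ≤ ‖w t‖` excludes the trivial solution `w t = 0` of `Q = G` while keeping the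
  -- set closed; by `hrQ` it loses no nonzero point.
  have hcl : IsClosed {t | Q (w t) ≤ G (w t) ∧ r ≤ ‖w t‖} :=
    (isClosed_le hQw hGw).inter (isClosed_le continuous_const w.continuous.norm)
  have hmem : ∀ {t}, w t ≠ 0 → Q (w t) ≤ G (w t) →
      t ∈ {t | Q (w t) ≤ G (w t) ∧ r ≤ ‖w t‖} := fun {t} ht hle =>
    ⟨hle, not_lt.mp fun hlt => (hrQ _ ht hlt).not_ge hle⟩
  have hw1 : w 1 ≠ 0 := by
    intro h'
    rw [hJ, h', h.quad_zero, h.hom_zero] at h1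
    simp at h1
  have hle1 : Q (w 1) ≤ G (w 1) := by
    have hQ1 := h.quad_pos hw1
    rw [hJ] at h1
    -- Once `G > 0`, `𝒥 < 0` gives `Q / 2 < G / q ≤ G / 2`.
    have hG : 0 < G (w 1) := by
      by_contra! hneg
      have : G (w 1) / q ≤ 0 := div_nonpos_of_nonpos_of_nonneg hneg (by linarith)
      linarith
    have : G (w 1) / q ≤ G (w 1) / 2 := by gcongr
    linarith
  obtain ⟨t, ht, hmin⟩ := hcl.isCompact.exists_isLeast ⟨1, hmem hw1 hle1⟩
  have hwt : w t ≠ 0 := norm_pos_iff.mp (hr.trans_le ht.2)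
  refine ⟨t, hwt, le_antisymm ht.1 ?_⟩
  have ht0 : 0 < t := by
    rw [unitInterval.pos_iff_ne_zero]
    rintro rfl
    exact hwt h0
  have hsub : Iio t ⊆ {s | G (w s) ≤ Q (w s)} := by
    intro s hs
    by_cases hws : w s = 0
    · simp [hws, h.quad_zero, h.hom_zero]
    · by_contra hlt
      exact (hmin (hmem hws (not_le.mp hlt).le)).not_gt hs
  have := closure_minimal hsub (isClosed_le hGw hQw)
  rw [closure_Iio' (show (Iio t).Nonempty from ⟨0, ht0⟩)] at this
  exact this (mem_Iic.mpr le_rfl)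

theorem exists_le_of_nehari (h : FiberedFunctional Q G q)
    (hJ : ∀ x, J x = Q x / 2 - G x / q) :
    ∃ d : ℝ, 0 < d ∧ ∀ x, x ≠ 0 → Q x = G x → d ≤ J x := by
  obtain ⟨r, hr, hrQ⟩ := h.exists_hom_lt_quad
  obtain ⟨c, hc, hQ⟩ := h.coercive
  have hq : 0 < 1 / 2 - 1 / q := by
    have := one_div_lt_one_div_of_lt two_pos h.two_lt
    linarith
  refine ⟨(1 / 2 - 1 / q) * (c * r ^ 2), by positivity, fun x hx hN => ?_⟩
  have hxr : r ≤ ‖x‖ := not_lt.mp fun hlt => (hrQ x hx hlt).ne' hN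
  have : c * r ^ 2 ≤ Q x := le_trans (by gcongr) (hQ x)
  calc (1 / 2 - 1 / q) * (c * r ^ 2) ≤ (1 / 2 - 1 / q) * Q x := by gcongr
    _ = J x := by rw [hJ, ← hN]; ring

theorem exists_path_le_ray (h : FiberedFunctional Q G q)
    (hJ : ∀ x, J x = Q x / 2 - G x / q) {x : X} (hx : 0 < G x) :
    ∃ w : C(unitInterval, X), w 0 = 0 ∧ J (w 1) < 0 ∧
      ∀ s, ∃ t : ℝ, 0 ≤ t ∧ J (w s) = J (t • x) := by
  have hq := h.two_lt
  -- The threshold on `T` is exactly `J (T • x) < 0`, after division by `T²`.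
  obtain ⟨T, hT, hlarge⟩ : ∃ T : ℝ, 0 < T ∧ Q x / 2 * q / G x < T ^ (q - 2) :=
    (((tendsto_rpow_atTop (by linarith : 0 < q - 2)).eventually_gt_atTop _).and
      (Filter.eventually_gt_atTop 0)).exists.imp fun _ h => ⟨h.2, h.1⟩
  refine ⟨⟨fun s => ((s : ℝ) * T) • x, by fun_prop⟩, by simp, ?_, fun s =>
    ⟨s * T, mul_nonneg s.2.1 hT.le, rfl⟩⟩
  have h2 : T ^ q = T ^ (q - 2) * T ^ 2 := by
    rw [← Real.rpow_two, ← Real.rpow_add hT]; congr 1; ring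
  simp only [ContinuousMap.coe_mk, Icc.coe_one, one_mul, hJ, h.quad_smul,
    h.hom_smul T x hT.le, h2]
  rw [div_lt_iff₀ hx, ← lt_div_iff₀ (by linarith)] at hlarge
  have : T ^ 2 * (Q x / 2) < T ^ 2 * (T ^ (q - 2) * G x / q) := by gcongr
  linarith [show T ^ 2 * (T ^ (q - 2) * G x / q) = T ^ (q - 2) * T ^ 2 * G x / q by ring]

theorem continuous_functional (h : FiberedFunctional Q G q)
    (hJ : ∀ x, J x = Q x / 2 - G x / q) : Continuous J := by
  rw [show J = fun x => Q x / 2 - G x / q from funext hJ]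
  exact (h.continuous_quad.div_const 2).sub (h.continuous_hom.div_const q)

theorem exists_isGreatest_path (h : FiberedFunctional Q G q)
    (hJ : ∀ x, J x = Q x / 2 - G x / q) (w : C(unitInterval, X)) :
    ∃ m, IsGreatest (range fun t => J (w t)) m :=
  (isCompact_range ((h.continuous_functional hJ).comp w.continuous)).exists_isGreatest
    (range_nonempty _)

theorem nehari_values_eq (h : FiberedFunctional Q G q) (hJ : ∀ x, J x = Q x / 2 - G x / q) :
    J '' {x | x ≠ 0 ∧ Q x = G x} =
      {m | ∃ x, 0 < G x ∧ IsGreatest ((fun t : ℝ => J (t • x)) '' Ici 0) m} := by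
  ext m
  constructor
  · rintro ⟨x, ⟨hx, hN⟩, rfl⟩
    exact ⟨x, hN ▸ h.quad_pos hx, h.isGreatest_ray_of_nehari hJ hx hN⟩
  · rintro ⟨x, hx, hm⟩
    obtain ⟨y, hy, hN, hm'⟩ := h.exists_nehari_isGreatest_ray hJ hx
    exact ⟨y, ⟨hy, hN⟩, hm'.unique hm⟩

theorem nehari_nonempty (h : FiberedFunctional Q G q) (hJ : ∀ x, J x = Q x / 2 - G x / q) :
    (J '' {x | x ≠ 0 ∧ Q x = G x}).Nonempty := by
  obtain ⟨x, hx⟩ := h.exists_pos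
  obtain ⟨y, hy, hN, -⟩ := h.exists_nehari_isGreatest_ray hJ hx
  exact ⟨J y, y, ⟨hy, hN⟩, rfl⟩

theorem sInf_nehari_pos (h : FiberedFunctional Q G q) (hJ : ∀ x, J x = Q x / 2 - G x / q) :
    0 < sInf (J '' {x | x ≠ 0 ∧ Q x = G x}) := by
  obtain ⟨d, hd, hle⟩ := h.exists_le_of_nehari hJ
  refine hd.trans_le (le_csInf (h.nehari_nonempty hJ) ?_)
  rintro _ ⟨x, hx, rfl⟩
  exact hle x hx.1 hx.2

/-- Each path maximum dominates a Nehari value, and each Nehari value dominates the maximum along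
some path, so the infima agree even if neither is attained. -/
theorem sInf_nehari_eq_sInf_path (h : FiberedFunctional Q G q)
    (hJ : ∀ x, J x = Q x / 2 - G x / q) :
    sInf (J '' {x | x ≠ 0 ∧ Q x = G x}) =
      sInf {m | ∃ w ∈ {w : C(unitInterval, X) | w 0 = 0 ∧ J (w 1) < 0},
        IsGreatest (range fun t => J (w t)) m} := by
  have hbdd : BddBelow (J '' {x | x ≠ 0 ∧ Q x = G x}) := by
    obtain ⟨d, -, hle⟩ := h.exists_le_of_nehari hJ
    refine ⟨d, ?_⟩
    rintro _ ⟨x, hx, rfl⟩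
    exact hle x hx.1 hx.2
  have hlow : ∀ m ∈ {m | ∃ w ∈ {w : C(unitInterval, X) | w 0 = 0 ∧ J (w 1) < 0},
      IsGreatest (range fun t => J (w t)) m}, sInf (J '' {x | x ≠ 0 ∧ Q x = G x}) ≤ m := by
    rintro m ⟨w, ⟨h0, h1⟩, hm⟩
    obtain ⟨t, ht, hN⟩ := h.exists_path_mem_nehari hJ h0 h1
    exact (csInf_le hbdd ⟨w t, ⟨ht, hN⟩, rfl⟩).trans (hm.2 ⟨t, rfl⟩)
  have hup : ∀ m ∈ J '' {x | x ≠ 0 ∧ Q x = G x},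
      ∃ m' ∈ {m | ∃ w ∈ {w : C(unitInterval, X) | w 0 = 0 ∧ J (w 1) < 0},
        IsGreatest (range fun t => J (w t)) m}, m' ≤ m := by
    rintro _ ⟨x, ⟨hx, hN⟩, rfl⟩
    obtain ⟨w, h0, h1, hw⟩ := h.exists_path_le_ray hJ (hN ▸ h.quad_pos hx)
    obtain ⟨m', hm'⟩ := h.exists_isGreatest_path hJ w
    refine ⟨m', ⟨w, ⟨h0, h1⟩, hm'⟩, ?_⟩
    obtain ⟨s, rfl⟩ := hm'.1
    obtain ⟨t, ht, hst⟩ := hw s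
    exact hst.trans_le ((h.isGreatest_ray_of_nehari hJ hx hN).2 ⟨t, ht, rfl⟩)
  obtain ⟨m, hm⟩ := h.nehari_nonempty hJ
  obtain ⟨m', hm', -⟩ := hup m hm
  refine le_antisymm (le_csInf ⟨m', hm'⟩ hlow) (le_csInf ⟨m, hm⟩ fun a ha => ?_)
  obtain ⟨b, hb, hba⟩ := hup a ha
  exact (csInf_le ⟨_, hlow⟩ hb).trans hba

end FiberedFunctional

/-! ### Continuity of the coupling integral on `L^p` -/

theorem abs_rpow_sub_rpow_le {s a c W : ℝ} (hs : 1 ≤ s) (ha : 0 ≤ a) (hc : 0 ≤ c)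
    (haW : a ≤ W) (hcW : c ≤ W) : |a ^ s - c ^ s| ≤ s * W ^ (s - 1) * |a - c| := by
  wlog hca : c ≤ a generalizing a c
  · rw [abs_sub_comm, abs_sub_comm a]
    exact this hc ha hcW haW (le_of_not_ge hca)
  have hle : c ^ s ≤ a ^ s := Real.rpow_le_rpow hc hca (by linarith)
  rw [abs_of_nonneg (sub_nonneg.mpr hle), abs_of_nonneg (sub_nonneg.mpr hca)]
  rcases ha.eq_or_lt with rfl | ha
  · obtain rfl : c = 0 := le_antisymm hca hc
    simp
  -- Bernoulli bounds `(c / a)^s` below by its tangent at `1`, in place of the mean value theorem.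
  have h := one_add_mul_self_le_rpow_one_add (s := c / a - 1)
    (by linarith [div_nonneg hc ha.le]) hs
  rw [show 1 + (c / a - 1) = c / a by ring, Real.div_rpow hc ha.le,
    le_div_iff₀ (by positivity)] at h
  have e : a ^ s = a ^ (s - 1) * a := by
    rw [← Real.rpow_add_one ha.ne', sub_add_cancel]
  calc a ^ s - c ^ s ≤ a ^ s - (1 + s * (c / a - 1)) * a ^ s := by linarith
    _ = s * a ^ (s - 1) * (a - c) := by rw [e]; field_simp; ring
    _ ≤ s * W ^ (s - 1) * (a - c) := by
      have := Real.rpow_le_rpow ha.le haW (by linarith : 0 ≤ s - 1)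
      have := sub_nonneg.mpr hca
      gcongr

/-- Split the difference as `|a|^s (b - d) + (|a|^s - |c|^s) d`. The right side has the form `W^s
Z`, so Hölder applies to it just as to the coupling itself; `|d|` is put into `W` to absorb the
factor `d`. -/
theorem abs_rpow_mul_sub_rpow_mul_le {s : ℝ} (hs : 1 ≤ s) (a b c d : ℝ) :
    |(|a| ^ s * b - |c| ^ s * d)| ≤
      s * ((|a| + |c| + |d|) ^ s * (|a - c| + |b - d|)) := by
  have ha := abs_nonneg a
  have hc := abs_nonneg c
  have hd := abs_nonneg d
  set W := |a| + |c| + |d| with hW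
  have hW0 : 0 ≤ W := by positivity
  have h1 : |(|a| ^ s * (b - d))| ≤ W ^ s * |b - d| := by
    rw [abs_mul, abs_of_nonneg (Real.rpow_nonneg ha s)]
    gcongr
    linarith
  have hWs : W ^ (s - 1) * W = W ^ s := by
    rcases hW0.eq_or_lt with h0 | h0
    · rw [← h0, mul_zero, Real.zero_rpow (by linarith)]
    · rw [← Real.rpow_add_one h0.ne', sub_add_cancel]
  have h2 : |(|a| ^ s - |c| ^ s) * d| ≤ s * W ^ s * |a - c| := by
    rw [abs_mul]
    calc _ ≤ (s * W ^ (s - 1) * |(|a| - |c|)|) * |d| := by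
          exact mul_le_mul_of_nonneg_right
            (abs_rpow_sub_rpow_le hs ha hc (by linarith) (by linarith)) hd
      _ ≤ (s * W ^ (s - 1) * |a - c|) * W := by
          exact mul_le_mul (mul_le_mul_of_nonneg_left (abs_abs_sub_abs_le a c) (by positivity))
            (by linarith) hd (by positivity)
      _ = _ := by rw [← hWs]; ring
  calc |(|a| ^ s * b - |c| ^ s * d)|
      = |(|a| ^ s * (b - d)) + (|a| ^ s - |c| ^ s) * d| := by congr 1; ring
    _ ≤ W ^ s * |b - d| + s * W ^ s * |a - c| := (abs_add_le _ _).trans (add_le_add h1 h2)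
    _ ≤ s * (W ^ s * |b - d|) + s * W ^ s * |a - c| := by
        exact add_le_add_left (le_mul_of_one_le_left (by positivity) hs) _
    _ = _ := by ring

section Lp

variable {α : Type*} [MeasurableSpace α] {m : Measure α} {p : ℝ}

theorem integral_abs_rpow_eq_norm_rpow (hp : 0 < p) (f : Lp ℝ (ENNReal.ofReal p) m) :
    ∫ x, |f x| ^ p ∂m = ‖f‖ ^ p := by
  have hint : 0 ≤ ∫ x, |f x| ^ p ∂m := integral_nonneg fun x => by positivity
  rw [Lp.norm_def, (Lp.memLp f).eLpNorm_eq_integral_rpow_norm (by simpa using hp)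
    ENNReal.ofReal_ne_top, ENNReal.toReal_ofReal hp.le]
  simp only [Real.norm_eq_abs]
  rw [ENNReal.toReal_ofReal (by positivity), Real.rpow_inv_rpow hint hp.ne']

theorem memLp_abs_rpow_sub_one (hp : 1 < p) (f : Lp ℝ (ENNReal.ofReal p) m) :
    MemLp (fun x => |f x| ^ (p - 1)) (ENNReal.ofReal p.conjExponent) m := by
  have h := (Lp.memLp f).norm_rpow_div (ENNReal.ofReal (p - 1))
  rw [ENNReal.toReal_ofReal (by linarith), ← ENNReal.ofReal_div_of_pos (by linarith)] at h
  simpa only [Real.norm_eq_abs, Real.conjExponent] using h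

theorem integrable_abs_rpow_mul (hp : 1 < p) (f g : Lp ℝ (ENNReal.ofReal p) m) :
    Integrable (fun x => |f x| ^ (p - 1) * g x) m := by
  have := (Real.HolderConjugate.conjExponent hp).symm.ennrealOfReal
  exact (memLp_abs_rpow_sub_one hp f).integrable_mul (Lp.memLp g)

theorem integral_abs_rpow_mul_abs_le (hp : 1 < p) (f g : Lp ℝ (ENNReal.ofReal p) m) :
    ∫ x, |f x| ^ (p - 1) * |g x| ∂m ≤ ‖f‖ ^ (p - 1) * ‖g‖ := by
  have hc := (Real.HolderConjugate.conjExponent hp).symm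
  have h := integral_mul_le_Lp_mul_Lq_of_nonneg hc
    (Filter.Eventually.of_forall fun x => Real.rpow_nonneg (abs_nonneg (f x)) (p - 1))
    (Filter.Eventually.of_forall fun x => abs_nonneg (g x))
    (memLp_abs_rpow_sub_one hp f) (Lp.memLp g).abs
  have hpp : 0 < p := by linarith
  have e1 : ∀ x, (|f x| ^ (p - 1)) ^ p.conjExponent = |f x| ^ p := fun x => by
    rw [← Real.rpow_mul (abs_nonneg _), Real.conjExponent, mul_div_cancel₀ _ (by linarith)]
  simp only [e1, integral_abs_rpow_eq_norm_rpow hpp] at h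
  have hn : ∀ k : Lp ℝ (ENNReal.ofReal p) m, 0 ≤ ‖k‖ := fun k => ENNReal.toReal_nonneg
  rwa [← Real.rpow_mul (hn f), ← Real.rpow_mul (hn g),
    mul_one_div_cancel hpp.ne', Real.rpow_one, Real.conjExponent,
    show p * (1 / (p / (p - 1))) = p - 1 by field_simp] at h

theorem abs_integral_abs_rpow_mul_le (hp : 1 < p) (f g : Lp ℝ (ENNReal.ofReal p) m) :
    |∫ x, |f x| ^ (p - 1) * g x ∂m| ≤ ‖f‖ ^ (p - 1) * ‖g‖ := by
  refine abs_integral_le_integral_abs.trans (le_trans (le_of_eq ?_)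
    (integral_abs_rpow_mul_abs_le hp f g))
  congr 1
  ext x
  rw [abs_mul, abs_of_nonneg (Real.rpow_nonneg (abs_nonneg _) _)]

theorem abs_integral_abs_rpow_mul_sub_le [Fact (1 ≤ ENNReal.ofReal p)] (hp : 2 ≤ p)
    (f g f' g' : Lp ℝ (ENNReal.ofReal p) m) :
    |∫ x, |f x| ^ (p - 1) * g x ∂m - ∫ x, |f' x| ^ (p - 1) * g' x ∂m| ≤
      (p - 1) * ((‖f‖ + ‖f'‖ + ‖g'‖) ^ (p - 1) * (‖f - f'‖ + ‖g - g'‖)) := by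
  have hp1 : 1 < p := by linarith
  rw [← integral_sub (integrable_abs_rpow_mul hp1 f g) (integrable_abs_rpow_mul hp1 f' g')]
  set W : Lp ℝ (ENNReal.ofReal p) m := |f| + |f'| + |g'| with hW
  set Z : Lp ℝ (ENNReal.ofReal p) m := |f - f'| + |g - g'| with hZ
  have hWn : ‖W‖ ≤ ‖f‖ + ‖f'‖ + ‖g'‖ := by
    refine (norm_add₃_le).trans (le_of_eq ?_)
    simp only [norm_abs_eq_norm]
  have hZn : ‖Z‖ ≤ ‖f - f'‖ + ‖g - g'‖ := by
    refine (norm_add_le _ _).trans (le_of_eq ?_)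
    simp only [norm_abs_eq_norm]
  have hbound : ∀ᵐ x ∂m, |(|f x| ^ (p - 1) * g x - |f' x| ^ (p - 1) * g' x)| ≤
      (p - 1) * (|W x| ^ (p - 1) * |Z x|) := by
    filter_upwards [Lp.coeFn_add (|f| + |f'|) |g'|, Lp.coeFn_add |f| |f'|, Lp.coeFn_abs f,
      Lp.coeFn_abs f', Lp.coeFn_abs g', Lp.coeFn_add |f - f'| |g - g'|, Lp.coeFn_abs (f - f'),
      Lp.coeFn_abs (g - g'), Lp.coeFn_sub f f', Lp.coeFn_sub g g']
      with x h1 h2 h3 h4 h5 h6 h7 h8 h9 h10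
    have eW : W x = |f x| + |f' x| + |g' x| := by
      rw [hW, h1, Pi.add_apply, h2, Pi.add_apply, h3, h4, h5]
    have eZ : Z x = |f x - f' x| + |g x - g' x| := by
      rw [hZ, h6, Pi.add_apply, h7, h8, h9, h10, Pi.sub_apply, Pi.sub_apply]
    rw [eW, eZ, abs_of_nonneg (by positivity : 0 ≤ |f x| + |f' x| + |g' x|),
      abs_of_nonneg (by positivity : 0 ≤ |f x - f' x| + |g x - g' x|)]
    exact abs_rpow_mul_sub_rpow_mul_le (by linarith) _ _ _ _
  have hint : Integrable (fun x => (p - 1) * (|W x| ^ (p - 1) * |Z x|)) m := by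
    refine ((integrable_abs_rpow_mul hp1 W Z).abs.congr ?_).const_mul _
    refine Filter.Eventually.of_forall fun x => ?_
    simp only [abs_mul]
    rw [abs_of_nonneg (Real.rpow_nonneg (abs_nonneg (W x)) _)]
  calc _ ≤ ∫ x, |(|f x| ^ (p - 1) * g x - |f' x| ^ (p - 1) * g' x)| ∂m :=
        abs_integral_le_integral_abs
    _ ≤ ∫ x, (p - 1) * (|W x| ^ (p - 1) * |Z x|) ∂m :=
        integral_mono_of_nonneg (Filter.Eventually.of_forall fun _ => abs_nonneg _) hint hbound
    _ = (p - 1) * ∫ x, |W x| ^ (p - 1) * |Z x| ∂m := integral_const_mul _ _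
    _ ≤ (p - 1) * (‖W‖ ^ (p - 1) * ‖Z‖) := by
        have := integral_abs_rpow_mul_abs_le hp1 W Z
        have : 0 ≤ p - 1 := by linarith
        gcongr
    _ ≤ _ := by
        have : 0 ≤ p - 1 := by linarith
        gcongr

theorem continuous_integral_abs_rpow_mul [Fact (1 ≤ ENNReal.ofReal p)] (hp : 2 ≤ p) :
    Continuous fun z : Lp ℝ (ENNReal.ofReal p) m × Lp ℝ (ENNReal.ofReal p) m =>
      ∫ x, |z.1 x| ^ (p - 1) * z.2 x ∂m := by
  rw [continuous_iff_continuousAt]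
  intro z₀
  rw [ContinuousAt, tendsto_iff_dist_tendsto_zero]
  have hcont : Continuous fun z : Lp ℝ (ENNReal.ofReal p) m × Lp ℝ (ENNReal.ofReal p) m =>
      (p - 1) * ((‖z.1‖ + ‖z₀.1‖ + ‖z₀.2‖) ^ (p - 1) * (‖z.1 - z₀.1‖ + ‖z.2 - z₀.2‖)) := by
    refine continuous_const.mul (Continuous.mul ?_ (by fun_prop))
    exact Continuous.rpow_const (by fun_prop) fun _ => Or.inr (by linarith)
  have hlim : Filter.Tendsto (fun z : Lp ℝ (ENNReal.ofReal p) m × Lp ℝ (ENNReal.ofReal p) m =>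
      (p - 1) * ((‖z.1‖ + ‖z₀.1‖ + ‖z₀.2‖) ^ (p - 1) * (‖z.1 - z₀.1‖ + ‖z.2 - z₀.2‖)))
      (nhds z₀) (nhds 0) := by
    simpa using hcont.tendsto z₀
  refine squeeze_zero (fun _ => dist_nonneg) (fun z => ?_) hlim
  rw [Real.dist_eq]
  exact abs_integral_abs_rpow_mul_sub_le hp z.1 z.2 z₀.1 z₀.2

end Lp

variable {N : ℕ} {Ω : Set (E N)}

/-! ### The Sobolev embedding -/

theorem two_lt_critExp (hN : 3 ≤ N) : 2 < critExp N := by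
  have : (3 : ℝ) ≤ N := by exact_mod_cast hN
  rw [critExp, lt_div_iff₀ (by linarith)]
  linarith

theorem fact_one_le_critExp (hN : 3 ≤ N) : Fact (1 ≤ ENNReal.ofReal (critExp N)) :=
  ⟨by simpa using (two_lt_critExp hN).le.trans' one_le_two⟩

theorem norm_gradient (φ : E N → ℝ) (x : E N) : ‖gradient φ x‖ = ‖fderiv ℝ φ x‖ := by
  simp [gradient]

/-- The Gagliardo–Nirenberg–Sobolev inequality on the whole space; restricting to `Ω` changes
neither norm because the supports lie in `Ω`. -/
theorem IsTestFunction.eLpNorm_le (hN : 3 ≤ N) {φ : E N → ℝ} (hφ : IsTestFunction Ω φ) :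
    eLpNorm φ (ENNReal.ofReal (critExp N)) (volume.restrict Ω) ≤
      SNormLESNormFDerivOfEqConst ℝ (volume : Measure (E N)) 2 *
        eLpNorm (gradient φ) 2 (volume.restrict Ω) := by
  have hN' : (3 : ℝ) ≤ N := by exact_mod_cast hN
  have hgrad : eLpNorm (gradient φ) 2 (volume.restrict Ω) = eLpNorm (fderiv ℝ φ) 2 volume := by
    rw [← eLpNorm_restrict_eq_of_support_subset (f := fderiv ℝ φ)
      ((support_fderiv_subset ℝ).trans hφ.supp)]
    exact eLpNorm_congr_norm_ae (Filter.Eventually.of_forall (norm_gradient φ))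
  rw [hgrad, eLpNorm_restrict_eq_of_support_subset ((subset_tsupport φ).trans hφ.supp)]
  refine eLpNorm_le_eLpNorm_fderiv_of_eq (p := 2) (p' := (critExp N).toNNReal) volume
    (hφ.smooth.of_le (by simp)) hφ.compact (by norm_num) (by simp; omega) ?_
  rw [Real.coe_toNNReal _ (by linarith [two_lt_critExp hN]), finrank_euclideanSpace_fin, critExp]
  push_cast
  have : (N : ℝ) - 2 ≠ 0 := by linarith
  field_simp

/-- Approximate by test functions, pass to a subsequence converging a.e., and apply Fatou on the
left; on the right the gradient norms converge. -/
theorem H10.eLpNorm_le (hN : 3 ≤ N) (u : H10 Ω) :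
    eLpNorm u.fn (ENNReal.ofReal (critExp N)) (volume.restrict Ω) ≤
      SNormLESNormFDerivOfEqConst ℝ (volume : Measure (E N)) 2 * ‖u.grad‖ₑ := by
  obtain ⟨x, hx, hlim⟩ := mem_closure_iff_seq_limit.mp u.2
  have hfst : Filter.Tendsto (fun n => (x n).fst) Filter.atTop (nhds u.fn) :=
    ((WithLp.continuous_fst 2 _ _).tendsto (u : L2Pair Ω)).comp hlim
  have hsnd : Filter.Tendsto (fun n => (x n).snd) Filter.atTop (nhds u.grad) :=
    ((WithLp.continuous_snd 2 _ _).tendsto (u : L2Pair Ω)).comp hlim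
  obtain ⟨ns, hns, hae⟩ := (tendstoInMeasure_of_tendsto_Lp hfst).exists_seq_tendsto_ae
  have hbound : ∀ n, eLpNorm (x n).fst (ENNReal.ofReal (critExp N)) (volume.restrict Ω) ≤
      SNormLESNormFDerivOfEqConst ℝ (volume : Measure (E N)) 2 * ‖(x n).snd‖ₑ := fun n => by
    obtain ⟨φ, hφ, h1, h2⟩ := hx n
    rw [Lp.enorm_def, eLpNorm_congr_ae h1, eLpNorm_congr_ae h2]
    exact hφ.eLpNorm_le hN
  have hright := (ENNReal.Tendsto.const_mul (hsnd.comp hns.tendsto_atTop).enorm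
    (Or.inr (ENNReal.coe_ne_top
      (r := SNormLESNormFDerivOfEqConst ℝ (volume : Measure (E N)) 2)))).liminf_eq
  refine (Lp.eLpNorm_lim_le_liminf_eLpNorm (fun n => (Lp.aestronglyMeasurable _)) _ hae).trans ?_
  refine le_trans (Filter.liminf_le_liminf (Filter.Eventually.of_forall fun n => hbound (ns n)))
    hright.le

theorem H10.memLp_critExp (hN : 3 ≤ N) (u : H10 Ω) :
    MemLp u.fn (ENNReal.ofReal (critExp N)) (volume.restrict Ω) :=
  ⟨Lp.aestronglyMeasurable _, (u.eLpNorm_le hN).trans_lt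
    (ENNReal.mul_lt_top ENNReal.coe_lt_top enorm_lt_top)⟩

theorem H10.norm_sq (u : H10 Ω) : ‖u‖ ^ 2 = ‖u.fn‖ ^ 2 + ‖u.grad‖ ^ 2 :=
  WithLp.prod_norm_sq_eq_of_L2 (u : L2Pair Ω)

theorem H10.norm_grad_le (u : H10 Ω) : ‖u.grad‖ ≤ ‖u‖ :=
  (sq_le_sq₀ (norm_nonneg _) (norm_nonneg _)).mp
    (by rw [u.norm_sq]; exact le_add_of_nonneg_left (sq_nonneg _))

/-- The Sobolev embedding `H¹₀(Ω) → L^{2^*}(Ω)`. -/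
theorem exists_sobolev_embedding (hN : 3 ≤ N) [Fact (1 ≤ ENNReal.ofReal (critExp N))] :
    ∃ T : H10 Ω →L[ℝ] Lp ℝ (ENNReal.ofReal (critExp N)) (volume.restrict Ω),
      ∀ u, T u =ᵐ[volume.restrict Ω] u.fn := by
  refine ⟨LinearMap.mkContinuous
    { toFun := fun u => (u.memLp_critExp hN).toLp u.fn
      map_add' := fun u v => ?_
      map_smul' := fun c u => ?_ }
    (SNormLESNormFDerivOfEqConst ℝ (volume : Measure (E N)) 2) fun u => ?_,
    fun u => (u.memLp_critExp hN).coeFn_toLp⟩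
  · rw [← MemLp.toLp_add]
    exact MemLp.toLp_congr _ _ (Lp.coeFn_add u.fn v.fn)
  · rw [RingHom.id_apply, ← MemLp.toLp_const_smul]
    exact MemLp.toLp_congr _ _ (Lp.coeFn_smul c u.fn)
  · refine le_trans ?_ (mul_le_mul_of_nonneg_left u.norm_grad_le (NNReal.coe_nonneg _))
    simp only [LinearMap.coe_mk, AddHom.coe_mk, Lp.norm_toLp]
    have := ENNReal.toReal_mono (ENNReal.mul_lt_top ENNReal.coe_lt_top enorm_lt_top).ne
      (u.eLpNorm_le hN)
    simpa [ENNReal.toReal_mul] using this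

/-! ### Quadratic integrals and the Poincaré inequality -/

theorem integral_norm_sq_eq {α F : Type*} [MeasurableSpace α] {m : Measure α}
    [NormedAddCommGroup F] (f : Lp F 2 m) : ∫ x, ‖f x‖ ^ 2 ∂m = ‖f‖ ^ 2 := by
  have hint : 0 ≤ ∫ x, ‖f x‖ ^ 2 ∂m := integral_nonneg fun x => by positivity
  rw [Lp.norm_def, (Lp.memLp f).eLpNorm_eq_integral_rpow_norm (by simp) (by simp)]
  simp only [ENNReal.toReal_ofNat, Real.rpow_two]
  rw [ENNReal.toReal_ofReal (by positivity), ← Real.rpow_two, Real.rpow_inv_rpow hint two_ne_zero]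

theorem massInt_eq (u : H10 Ω) : massInt u = ‖u.fn‖ ^ 2 := integral_norm_sq_eq u.fn

theorem dirichletInt_eq (u : H10 Ω) : dirichletInt u = ‖u.grad‖ ^ 2 := integral_norm_sq_eq u.grad

theorem firstEigenvalue_mul_massInt_le (u : H10 Ω) :
    firstEigenvalue Ω * massInt u ≤ dirichletInt u := by
  by_cases hu : u.fn = 0
  · rw [massInt_eq, dirichletInt_eq, hu, norm_zero]
    simp only [ne_eq, OfNat.ofNat_ne_zero, not_false_eq_true, zero_pow, mul_zero]
    positivity
  · have hpos : 0 < massInt u := by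
      rw [massInt_eq]
      have := norm_pos_iff.mpr hu
      positivity
    rw [← le_div_iff₀ hpos]
    refine csInf_le ⟨0, ?_⟩ ⟨u, hu, rfl⟩
    rintro _ ⟨v, -, rfl⟩
    rw [massInt_eq, dirichletInt_eq]
    positivity

theorem norm_sq_le_dirichletInt (h : 0 < firstEigenvalue Ω) (u : H10 Ω) :
    ‖u‖ ^ 2 ≤ (1 + 1 / firstEigenvalue Ω) * dirichletInt u := by
  have := firstEigenvalue_mul_massInt_le u
  rw [mul_comm, ← le_div_iff₀ h] at this
  rw [u.norm_sq, ← massInt_eq, ← dirichletInt_eq]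
  linarith [show (1 + 1 / firstEigenvalue Ω) * dirichletInt u
    = dirichletInt u + dirichletInt u / firstEigenvalue Ω by ring]

theorem continuous_massInt : Continuous (massInt : H10 Ω → ℝ) := by
  simp only [funext massInt_eq]
  exact (((WithLp.continuous_fst 2 _ _).comp continuous_subtype_val).norm).pow 2

theorem continuous_dirichletInt : Continuous (dirichletInt : H10 Ω → ℝ) := by
  simp only [funext dirichletInt_eq]
  exact (((WithLp.continuous_snd 2 _ _).comp continuous_subtype_val).norm).pow 2

theorem massInt_smul (t : ℝ) (u : H10 Ω) : massInt (t • u) = t ^ 2 * massInt u := by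
  rw [massInt_eq, massInt_eq, show (t • u).fn = t • u.fn from rfl, norm_smul, mul_pow,
    Real.norm_eq_abs, sq_abs]

theorem dirichletInt_smul (t : ℝ) (u : H10 Ω) : dirichletInt (t • u) = t ^ 2 * dirichletInt u := by
  rw [dirichletInt_eq, dirichletInt_eq, show (t • u).grad = t • u.grad from rfl, norm_smul,
    mul_pow, Real.norm_eq_abs, sq_abs]

/-! ### A nonzero nonnegative element of `H¹₀(Ω)` -/

theorem exists_H10_of_isTestFunction {φ : E N → ℝ} (hφ : IsTestFunction Ω φ) :
    ∃ u : H10 Ω, u.fn =ᵐ[volume.restrict Ω] φ := by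
  have h1 : MemLp φ 2 (volume.restrict Ω) :=
    (hφ.smooth.continuous.memLp_of_hasCompactSupport hφ.compact).restrict Ω
  have hcont : Continuous (gradient φ) :=
    (InnerProductSpace.toDual ℝ (E N)).symm.continuous.comp
      (hφ.smooth.continuous_fderiv (by simp))
  have hsupp : HasCompactSupport (gradient φ) :=
    (hφ.compact.fderiv ℝ).comp_left (map_zero (InnerProductSpace.toDual ℝ (E N)).symm)
  have h2 : MemLp (gradient φ) 2 (volume.restrict Ω) :=
    (hcont.memLp_of_hasCompactSupport hsupp).restrict Ω
  exact ⟨⟨WithLp.toLp 2 (h1.toLp φ, h2.toLp _), subset_closure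
    ⟨φ, hφ, h1.coeFn_toLp, h2.coeFn_toLp⟩⟩, h1.coeFn_toLp⟩

theorem exists_nonneg_H10 (hΩ : IsOpen Ω) (hne : Ω.Nonempty) :
    ∃ u : H10 Ω, u.fn ≠ 0 ∧ ∀ᵐ x ∂volume.restrict Ω, 0 ≤ u.fn x := by
  obtain ⟨x, hx⟩ := hne
  obtain ⟨φ, hsupp, hcomp, hsmooth, hrange, hφx⟩ :=
    exists_contDiff_tsupport_subset (n := ⊤) (hΩ.mem_nhds hx)
  obtain ⟨u, hu⟩ := exists_H10_of_isTestFunction ⟨hsmooth, hcomp, hsupp⟩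
  refine ⟨u, fun h0 => ?_, ?_⟩
  · have hae : φ =ᵐ[volume.restrict Ω] (0 : E N → ℝ) :=
      hu.symm.trans (h0 ▸ Lp.coeFn_zero ℝ 2 (volume.restrict Ω))
    have := Measure.eqOn_open_of_ae_eq hae hΩ hsmooth.continuous.continuousOn
      continuousOn_const hx
    rw [hφx] at this
    exact one_ne_zero this
  · filter_upwards [hu] with y hy
    rw [hy]
    exact (hrange ⟨y, rfl⟩).1

/-! ### The energy as a fibered functional -/

/-- The quadratic part of the energy. -/
noncomputable def quadPart (lam : ℝ) (p : H10 Ω × H10 Ω) : ℝ :=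
  dirichletInt p.1 - lam * massInt p.1 + 1 / (critExp N - 1) * dirichletInt p.2

/-- The part of the energy that is homogeneous of degree `2^*`. -/
noncomputable def critPart (μ : ℝ) (p : H10 Ω × H10 Ω) : ℝ :=
  (μ * critInt p.2 + critExp N * couplingInt p.1 p.2) / (critExp N - 1)

theorem energy_eq (hN : 3 ≤ N) (lam μ : ℝ) (p : H10 Ω × H10 Ω) :
    energy lam μ p = quadPart lam p / 2 - critPart μ p / critExp N := by
  have h := two_lt_critExp hN
  have h1 : critExp N - 1 ≠ 0 := by linarith
  have h2 : critExp N ≠ 0 := by linarith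
  rw [energy, quadPart, critPart]
  field_simp
  ring

/-- By homogeneity this is the derivative of `t ↦ 𝒥(tp)` at `t = 1`. -/
theorem nehariFun_eq (lam μ : ℝ) (p : H10 Ω × H10 Ω) :
    nehariFun lam μ p = quadPart lam p - critPart μ p := by
  rw [nehariFun, quadPart, critPart]
  ring

section Embedding

variable [Fact (1 ≤ ENNReal.ofReal (critExp N))]
  {T : H10 Ω →L[ℝ] Lp ℝ (ENNReal.ofReal (critExp N)) (volume.restrict Ω)}

theorem critInt_eq (hN : 3 ≤ N) (hT : ∀ u, T u =ᵐ[volume.restrict Ω] u.fn) (v : H10 Ω) :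
    critInt v = ‖T v‖ ^ critExp N := by
  rw [← integral_abs_rpow_eq_norm_rpow (by linarith [two_lt_critExp hN])]
  refine integral_congr_ae ?_
  filter_upwards [hT v] with x hx
  rw [hx]

theorem couplingInt_eq (hT : ∀ u, T u =ᵐ[volume.restrict Ω] u.fn) (u v : H10 Ω) :
    couplingInt u v = ∫ x in Ω, |T u x| ^ (critExp N - 1) * T v x := by
  refine integral_congr_ae ?_
  filter_upwards [hT u, hT v] with x hx hy
  rw [hx, hy]

end Embedding

theorem continuous_critPart (hN : 3 ≤ N) (μ : ℝ) :
    Continuous (critPart μ : H10 Ω × H10 Ω → ℝ) := by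
  have := fact_one_le_critExp hN
  have h := two_lt_critExp hN
  obtain ⟨T, hT⟩ := exists_sobolev_embedding (Ω := Ω) hN
  unfold critPart
  simp only [critInt_eq hN hT, couplingInt_eq hT]
  refine Continuous.div_const (Continuous.add (continuous_const.mul ?_)
    (continuous_const.mul ?_)) _
  · exact Continuous.rpow_const (by fun_prop) fun _ => Or.inr (by linarith)
  · exact (continuous_integral_abs_rpow_mul h.le).comp
      (f := fun p : H10 Ω × H10 Ω => (T p.1, T p.2)) (by fun_prop)

theorem critInt_smul (hN : 3 ≤ N) {t : ℝ} (ht : 0 ≤ t) (v : H10 Ω) :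
    critInt (t • v) = t ^ critExp N * critInt v := by
  have := fact_one_le_critExp hN
  obtain ⟨T, hT⟩ := exists_sobolev_embedding (Ω := Ω) hN
  rw [critInt_eq hN hT, critInt_eq hN hT, map_smul, norm_smul, Real.norm_of_nonneg ht,
    Real.mul_rpow ht (norm_nonneg _)]

theorem couplingInt_smul (hN : 3 ≤ N) {t : ℝ} (ht : 0 ≤ t) (u v : H10 Ω) :
    couplingInt (t • u) (t • v) = t ^ critExp N * couplingInt u v := by
  have h := two_lt_critExp hN
  rw [couplingInt, couplingInt, ← integral_const_mul]
  refine integral_congr_ae ?_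
  filter_upwards [Lp.coeFn_smul t u.fn, Lp.coeFn_smul t v.fn] with x hx hy
  rw [show (t • u).fn = t • u.fn from rfl, show (t • v).fn = t • v.fn from rfl, hx, hy,
    Pi.smul_apply, Pi.smul_apply, smul_eq_mul, smul_eq_mul, abs_mul, abs_of_nonneg ht,
    Real.mul_rpow ht (abs_nonneg _)]
  have e : t ^ critExp N = t ^ (critExp N - 1) * t := by
    rcases ht.eq_or_lt with rfl | ht
    · rw [mul_zero, Real.zero_rpow (by linarith)]
    · rw [← Real.rpow_add_one ht.ne', sub_add_cancel]
  rw [e]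
  ring

theorem exists_critPart_le (hN : 3 ≤ N) {μ : ℝ} (hμ : 0 ≤ μ) :
    ∃ C : ℝ, 0 < C ∧ ∀ p : H10 Ω × H10 Ω, critPart μ p ≤ C * ‖p‖ ^ critExp N := by
  have := fact_one_le_critExp hN
  have h := two_lt_critExp hN
  obtain ⟨T, hT⟩ := exists_sobolev_embedding (Ω := Ω) hN
  have h1 : 0 < critExp N - 1 := by linarith
  refine ⟨(μ + critExp N) * (‖T‖ + 1) ^ critExp N / (critExp N - 1), by positivity, fun p => ?_⟩
  -- A common bound for the `L^{2^*}` norms of both components, so both integrals are at most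
  -- `R^{2^*}`.
  set R := (‖T‖ + 1) * ‖p‖ with hR
  have hle : ∀ u : H10 Ω, ‖u‖ ≤ ‖p‖ → ‖T u‖ ≤ R := fun u hu =>
    (T.le_opNorm u).trans (by rw [hR]; gcongr; linarith)
  have hu := hle p.1 (norm_fst_le p)
  have hv := hle p.2 (norm_snd_le p)
  have hR0 : 0 ≤ R := by positivity
  have hcrit : critInt p.2 ≤ R ^ critExp N := by
    rw [critInt_eq hN hT]
    gcongr
  have hcoup : couplingInt p.1 p.2 ≤ R ^ critExp N := by
    rw [couplingInt_eq hT]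
    refine (le_abs_self _).trans ((abs_integral_abs_rpow_mul_le (by linarith) _ _).trans ?_)
    calc _ ≤ R ^ (critExp N - 1) * R := by gcongr
      _ = R ^ critExp N := by
        rcases hR0.eq_or_lt with h0 | h0
        · rw [← h0, mul_zero, Real.zero_rpow (by linarith)]
        · rw [← Real.rpow_add_one h0.ne', sub_add_cancel]
  have e : R ^ critExp N = (‖T‖ + 1) ^ critExp N * ‖p‖ ^ critExp N :=
    Real.mul_rpow (by positivity) (norm_nonneg _)
  calc critPart μ p ≤ (μ * R ^ critExp N + critExp N * R ^ critExp N) / (critExp N - 1) := by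
        unfold critPart
        gcongr
    _ = _ := by rw [e]; ring

theorem exists_critPart_pos (hN : 3 ≤ N) (hΩ : IsOpen Ω) (hne : Ω.Nonempty) {μ : ℝ}
    (hμ : 0 ≤ μ) : ∃ p : H10 Ω × H10 Ω, 0 < critPart μ p := by
  have := fact_one_le_critExp hN
  have h := two_lt_critExp hN
  obtain ⟨T, hT⟩ := exists_sobolev_embedding (Ω := Ω) hN
  obtain ⟨u, hu0, hu⟩ := exists_nonneg_H10 hΩ hne
  have hTu : T u ≠ 0 := fun h0 => hu0 <| Lp.ext <|
    (hT u).symm.trans ((h0 ▸ Lp.coeFn_zero ℝ (ENNReal.ofReal (critExp N)) _).trans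
      (Lp.coeFn_zero ℝ 2 _).symm)
  have hpos : 0 < critInt u := by
    rw [critInt_eq hN hT]
    have := norm_pos_iff.mpr hTu
    positivity
  have hcoup : couplingInt u u = critInt u := by
    refine integral_congr_ae ?_
    filter_upwards [hu] with x hx
    simp only [abs_of_nonneg hx]
    rcases hx.eq_or_lt with h0 | h0
    · rw [← h0, mul_zero, Real.zero_rpow (by linarith)]
    · rw [← Real.rpow_add_one h0.ne', sub_add_cancel]
  -- On the diagonal, with `u ≥ 0`, the coupling equals `critInt u > 0`, so positivity holds even
  -- for `μ = 0`.
  refine ⟨(u, u), ?_⟩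
  have h1 : 0 < critExp N - 1 := by linarith
  have h2 : 0 < critExp N := by linarith
  simp only [critPart, hcoup]
  positivity

/-- The mass term absorbs at most the fraction `λ / λ₁ < 1` of the first Dirichlet integral;
Poincaré then recovers the full `H¹` norms. -/
theorem exists_quadPart_ge (hN : 3 ≤ N) {lam : ℝ} (hlam : lam ∈ Ioo 0 (firstEigenvalue Ω)) :
    ∃ c : ℝ, 0 < c ∧ ∀ p : H10 Ω × H10 Ω, c * ‖p‖ ^ 2 ≤ quadPart lam p := by
  obtain ⟨hl0, hl1⟩ := hlam
  have hlam1 := hl0.trans hl1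
  have h := two_lt_critExp hN
  set Λ := firstEigenvalue Ω with hΛ
  have h1 : 0 < critExp N - 1 := by linarith
  have hr : 0 < 1 - lam / Λ := by rw [sub_pos, div_lt_one hlam1]; exact hl1
  set b := min (1 - lam / Λ) (1 / (critExp N - 1)) with hb
  have hb0 : 0 < b := lt_min hr (by positivity)
  refine ⟨b / (1 + 1 / Λ), by positivity, fun p => ?_⟩
  have hD1 : 0 ≤ dirichletInt p.1 := by rw [dirichletInt_eq]; positivity
  have hD2 : 0 ≤ dirichletInt p.2 := by rw [dirichletInt_eq]; positivity
  have hm : lam * massInt p.1 ≤ lam / Λ * dirichletInt p.1 := by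
    have := firstEigenvalue_mul_massInt_le p.1
    calc lam * massInt p.1 = lam / Λ * (Λ * massInt p.1) := by field_simp
      _ ≤ _ := by gcongr
  have hq : b * (dirichletInt p.1 + dirichletInt p.2) ≤ quadPart lam p := by
    have e1 : b * dirichletInt p.1 ≤ (1 - lam / Λ) * dirichletInt p.1 := by
      gcongr
      exact min_le_left _ _
    have e2 : b * dirichletInt p.2 ≤ 1 / (critExp N - 1) * dirichletInt p.2 := by
      gcongr
      exact min_le_right _ _
    rw [quadPart]
    linarith
  have hn : ‖p‖ ^ 2 ≤ (1 + 1 / Λ) * (dirichletInt p.1 + dirichletInt p.2) := by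
    have n1 := norm_sq_le_dirichletInt hlam1 p.1
    have n2 := norm_sq_le_dirichletInt hlam1 p.2
    have hc : 0 ≤ 1 + 1 / Λ := by positivity
    have m1 := mul_nonneg hc hD1
    have m2 := mul_nonneg hc hD2
    rw [Prod.norm_def]
    -- The product carries the sup norm, so its square is one of the two squared norms.
    rcases max_choice ‖p.1‖ ‖p.2‖ with h' | h' <;> rw [h'] <;> linarith
  calc b / (1 + 1 / Λ) * ‖p‖ ^ 2
      ≤ b / (1 + 1 / Λ) * ((1 + 1 / Λ) * (dirichletInt p.1 + dirichletInt p.2)) := by gcongr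
    _ = b * (dirichletInt p.1 + dirichletInt p.2) := by field_simp
    _ ≤ _ := hq

theorem fiberedFunctional_energy (hN : 3 ≤ N) (hΩ : IsOpen Ω) (hne : Ω.Nonempty) {lam μ : ℝ}
    (hlam : lam ∈ Ioo 0 (firstEigenvalue Ω)) (hμ : 0 ≤ μ) :
    FiberedFunctional (quadPart lam : H10 Ω × H10 Ω → ℝ) (critPart μ) (critExp N) where
  two_lt := two_lt_critExp hN
  continuous_quad := ((continuous_dirichletInt.comp continuous_fst).sub
    ((continuous_massInt.comp continuous_fst).const_mul lam)).add
      ((continuous_dirichletInt.comp continuous_snd).const_mul _)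
  continuous_hom := continuous_critPart hN μ
  quad_smul t p := by
    simp only [quadPart, Prod.smul_fst, Prod.smul_snd, massInt_smul, dirichletInt_smul]
    ring
  hom_smul t p ht := by
    simp only [critPart, Prod.smul_fst, Prod.smul_snd, critInt_smul hN ht,
      couplingInt_smul hN ht]
    ring
  coercive := exists_quadPart_ge hN hlam
  growth := exists_critPart_le hN hμ
  exists_pos := exists_critPart_pos hN hΩ hne hμ

theorem nonneg_of_mem_paramRange {μ : ℝ} (hμ : μ ∈ paramRange N) : 0 ≤ μ := by
  unfold paramRange at hμ
  split_ifs at hμ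
  · exact hμ.1
  · exact hμ.1
  · exact hμ.1
  · exact hμ

theorem nehariSet_eq (lam μ : ℝ) :
    nehariSet Ω lam μ = {p | p ≠ 0 ∧ quadPart lam p = critPart μ p} := by
  ext p
  simp only [nehariSet, mem_ofPred_eq, nehariFun_eq, sub_eq_zero]

theorem mem_admissible_iff (hN : 3 ≤ N) {μ : ℝ} {p : H10 Ω × H10 Ω} :
    p ∈ admissible Ω μ ↔ 0 < critPart μ p := by
  have h1 : 0 < critExp N - 1 := by linarith [two_lt_critExp hN]
  rw [critPart, div_pos_iff_of_pos_right h1]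
  rfl

end CriticalSystem

theorem proposition3p3 (N : ℕ) (hN : 4 ≤ N)
    (Ω : Set (EuclideanSpace ℝ (Fin N)))
    (hΩo : IsOpen Ω) (hΩc : IsConnected Ω) (hΩb : Bornology.IsBounded Ω)
    (lam μ : ℝ) (hlam : lam ∈ Set.Ioo 0 (CriticalSystem.firstEigenvalue Ω))
    (hμ : μ ∈ CriticalSystem.paramRange N) :
    -- the maxima in the minimax levels are attained
    (∀ p ∈ CriticalSystem.admissible Ω μ,
      ∃ m, IsGreatest (CriticalSystem.rayValues lam μ p) m) ∧
    (∀ w ∈ CriticalSystem.paths Ω lam μ,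
      ∃ m, IsGreatest (CriticalSystem.pathValues lam μ w) m) ∧
    CriticalSystem.nehariLevel Ω lam μ = CriticalSystem.admissibleLevel Ω lam μ ∧
    CriticalSystem.admissibleLevel Ω lam μ = CriticalSystem.mountainPassLevel Ω lam μ ∧
    0 < CriticalSystem.mountainPassLevel Ω lam μ := by
  have hN3 : 3 ≤ N := by omega
  have h := CriticalSystem.fiberedFunctional_energy hN3 hΩo hΩc.nonempty hlam
    (CriticalSystem.nonneg_of_mem_paramRange hμ)
  have hJ := CriticalSystem.energy_eq (Ω := Ω) hN3 lam μ
  have hlevel : CriticalSystem.nehariLevel Ω lam μ = CriticalSystem.admissibleLevel Ω lam μ := by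
    rw [CriticalSystem.nehariLevel, CriticalSystem.nehariSet_eq, h.nehari_values_eq hJ]
    simp only [CriticalSystem.admissibleLevel, CriticalSystem.mem_admissible_iff hN3]
    rfl
  have hpath : CriticalSystem.nehariLevel Ω lam μ =
      CriticalSystem.mountainPassLevel Ω lam μ := by
    rw [CriticalSystem.nehariLevel, CriticalSystem.nehariSet_eq]
    exact h.sInf_nehari_eq_sInf_path hJ
  refine ⟨fun p hp => ?_, fun w _ => h.exists_isGreatest_path hJ w, hlevel,
    hlevel.symm.trans hpath, ?_⟩
  · obtain ⟨y, -, -, hy⟩ := h.exists_nehari_isGreatest_ray hJ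
      ((CriticalSystem.mem_admissible_iff hN3).mp hp)
    exact ⟨_, hy⟩
  · rw [← hpath, CriticalSystem.nehariLevel, CriticalSystem.nehariSet_eq]
    exact h.sInf_nehari_pos hJ
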